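/- Let $k$ be a field and let $(\mathcal C,\otimes,I,C)$ be a braided tensor category that is concrete over $k$-vector spaces: there is a faithful, isomorphism-reflecting (strong) monoidal functor $F$ from $\mathcal C$ to the category of $k$-vector spaces, $F(X)$ being the underlying vector space of $X$ (so the underlying space of $X\otimes Y$ is the tensor product over $k$, and bijective morphisms are invertible). Bialgebras and Hopf algebras, and their morphisms, are those in $\mathcal C$. Associativity constraints are suppressed. Definitions. Let $A,H$ be bialgebras in $\mathcal C$ and let $\alpha:H\otimes A\to A$, $\beta:H\otimes A\to H$ be morphisms such that $(A,\alpha)$ is a left $H$-module coalgebra and $(H,\beta)$ is a right $A$-module coalgebra. The double cross product $A\,{}_\alpha\!\bowtie_\beta H$ is the object $A\otimes H$ with unit $\eta_A\otimes\eta_H$, counit $\epsilon_A\otimes\epsilon_H$, comultiplication $(\mathrm{id}\otimes C_{A,H}\otimes\mathrm{id})(\Delta_A\otimes\Delta_H)$ and multiplication $$(m_A\otimes m_H)(\mathrm{id}\otimes\alpha\otimes\beta\otimes\mathrm{id})(\mathrm{id}\otimes\mathrm{id}\otimes C_{H,A}\otimes\mathrm{id}\otimes\mathrm{id})(\mathrm{id}\otimes\Delta_H\otimes\Delta_A\otimes\mathrm{id}).$$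 Let $n\ge 2$, let $\sigma$ be a full binary bracketing of $n$ factors, and let $j_{A_i}:A_i\to H$ $(1\le i\le n)$ be morphisms of bialgebras (respectively Hopf algebras) in $\mathcal C$. For $l\le r$ write $j_{A_l}(A_l)\cdots j_{A_r}(A_r)\subseteq H$ for the span of the products of elements of the images. The family $(j_{A_i})$ is a double factorization of $H$ with respect to $\sigma$ if $j_{A_1}(A_1)\cdots j_{A_n}(A_n)=H$ and, for every pair of brackets $(A_l\otimes\cdots\otimes A_{l+t})$ of $\sigma$ (including the outermost one), the subspace $j_{A_l}(A_l)\cdots j_{A_{l+t}}(A_{l+t})$ is a sub-bialgebra (respectively sub-Hopf algebra) $B$ of $H$ in $\mathcal C$ and $m_H^{t}(j_{A_l}\otimes\cdots\otimes j_{A_{l+t}})$ is, as a morphism of $\mathcal C$, a bijective map from $A_l\otimes\cdots\otimes A_{l+t}$ onto $B$. Here a sub-bialgebra (sub-Hopf algebra) with underlying subspace $P\subseteq H$ is a bialgebra (Hopf algebra) $B$ in $\mathcal C$ with an injective bialgebra morphism $B\to H$ whose image is $P$, and the second condition says that the iterated multiplication factors through $B\to H$ by a bijective morphism of $\mathcal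 C$. Theorem. If $(j_{A_i})_{1\le i\le n}$ is a double factorization of the bialgebra (respectively Hopf algebra) $H$ with respect to $\sigma$, then there are morphisms $\alpha_i,\beta_i$ $(1\le i\le n-1)$ in $\mathcal C$, one pair for each pair of brackets of $\sigma$, such that, for every pair of brackets, $\alpha_i$ and $\beta_i$ are module coalgebra structures as above between the double cross products obtained from its two parts, the resulting double cross product is a bialgebra (respectively Hopf algebra), and $$m_H^{n-1}(j_{A_1}\otimes\cdots\otimes j_{A_n}):\ \sigma(A_1\,{}_{\alpha_1}\!\bowtie_{\beta_1}A_2\,{}_{\alpha_2}\!\bowtie_{\beta_2}\cdots{}_{\alpha_{n-1}}\!\bowtie_{\beta_{n-1}}A_n)\longrightarrow H$$ is an isomorphism of bialgebras (respectively Hopf algebras) in $\mathcal C$. -/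

import Mathlib

open CategoryTheory MonoidalCategory
open scoped MonObj ComonObj

universe w v u

attribute [local instance 2000] CategoryStruct.toQuiver

namespace BraidedFactorization

/-- A method of adding brackets for `n` factors: a full binary bracketing of a word of length `n`
(`single` is one factor without brackets, `pair s t` is the pair of brackets `(s t)`). -/
inductive Bracketing : ℕ → Type
  | single : Bracketing 1
  | pair {p q : ℕ} (s : Bracketing p) (t : Bracketing q) : Bracketing (p + q)

section DoubleCross

variable {C : Type u} [Category.{v} C] [MonoidalCategory C] [BraidedCategory C]

/-- `(A, act)` is a left `H`-module coalgebra: `act` is an associative and unital left action and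
a coalgebra morphism, where `H ⊗ A` has the tensor product coalgebra structure. -/
structure IsLeftModuleCoalgebra (H A : C) [BimonObj H] [BimonObj A] (act : H ⊗ A ⟶ A) : Prop where
  one_act : η[H] ▷ A ≫ act = (λ_ A).hom
  mul_act : μ[H] ▷ A ≫ act = (α_ H H A).hom ≫ H ◁ act ≫ act
  act_comul : act ≫ Δ[A] = (Δ[H] ⊗ₘ Δ[A]) ≫ tensorμ H H A A ≫ (act ⊗ₘ act)
  act_counit : act ≫ ε[A] = (ε[H] ⊗ₘ ε[A]) ≫ (λ_ (𝟙_ C)).hom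

/-- `(H, act)` is a right `A`-module coalgebra. -/
structure IsRightModuleCoalgebra (H A : C) [BimonObj H] [BimonObj A] (act : H ⊗ A ⟶ H) : Prop where
  act_one : H ◁ η[A] ≫ act = (ρ_ H).hom
  act_mul : H ◁ μ[A] ≫ act = (α_ H A A).inv ≫ act ▷ A ≫ act
  act_comul : act ≫ Δ[H] = (Δ[H] ⊗ₘ Δ[A]) ≫ tensorμ H H A A ≫ (act ⊗ₘ act)
  act_counit : act ≫ ε[H] = (ε[H] ⊗ₘ ε[A]) ≫ (λ_ (𝟙_ C)).hom

/-- The multiplication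
`(m_A ⊗ m_H)(id ⊗ a ⊗ b ⊗ id)(id ⊗ id ⊗ C_{H,A} ⊗ id ⊗ id)(id ⊗ Δ_H ⊗ Δ_A ⊗ id)`
of the double cross product on `A ⊗ H`, with associators inserted. -/
def crossMul (A H : C) [BimonObj A] [BimonObj H] (a : H ⊗ A ⟶ A) (b : H ⊗ A ⟶ H) :
    (A ⊗ H) ⊗ (A ⊗ H) ⟶ A ⊗ H :=
  (α_ A H (A ⊗ H)).hom ≫ A ◁ (α_ H A H).inv ≫
    A ◁ (((Δ[H] ⊗ₘ Δ[A]) ≫ tensorμ H H A A ≫ (a ⊗ₘ b)) ▷ H) ≫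
    A ◁ (α_ A H H).hom ≫ (α_ A A (H ⊗ H)).inv ≫ (μ[A] ⊗ₘ μ[H])

/-- The bialgebra structure `S` on `A ⊗ H` is the double cross product of `A` and `H` along the
actions `a` and `b`. As the coactions of `H` on `A` and of `A` on `H` are trivial, the
comultiplication is that of the tensor product coalgebra. -/
structure IsDoubleCrossProduct (A H : C) [BimonObj A] [BimonObj H]
    (a : H ⊗ A ⟶ A) (b : H ⊗ A ⟶ H) (S : BimonObj (A ⊗ H)) : Prop where
  left_module : IsLeftModuleCoalgebra H A a
  right_module : IsRightModuleCoalgebra H A b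
  mul_eq : S.mul = crossMul A H a b
  one_eq : S.one = (λ_ (𝟙_ C)).inv ≫ (η[A] ⊗ₘ η[H])
  comul_eq : S.comul = (Δ[A] ⊗ₘ Δ[H]) ≫ tensorμ A A H H
  counit_eq : S.counit = (ε[A] ⊗ₘ ε[H]) ≫ (λ_ (𝟙_ C)).hom

namespace Bracketing

/-- The tensor product `A₁ ⊗ ⋯ ⊗ Aₙ`, bracketed by the given bracketing. -/
def obj : {n : ℕ} → Bracketing n → (Fin n → C) → C
  | _, single, A => A 0
  | _, pair (p := p) (q := q) s t, A =>
      obj s (fun i => A (Fin.castAdd q i)) ⊗ obj t (fun i => A (Fin.natAdd p i))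

/-- The iterated multiplication `m_H^{n-1} (j₁ ⊗ ⋯ ⊗ jₙ) : A₁ ⊗ ⋯ ⊗ Aₙ ⟶ H`, where the source is
bracketed by the given bracketing (by associativity of `m_H`, all bracketings of the source give
the same morphism up to the associativity constraint). -/
def iterMul {H : C} [MonObj H] :
    {n : ℕ} → (σ : Bracketing n) → (A : Fin n → C) → (∀ i, A i ⟶ H) → (σ.obj A ⟶ H)
  | _, single, _, j => j 0
  | _, pair (p := p) (q := q) s t, A, j =>
      (iterMul s (fun i => A (Fin.castAdd q i)) (fun i => j (Fin.castAdd q i)) ⊗ₘ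
        iterMul t (fun i => A (Fin.natAdd p i)) (fun i => j (Fin.natAdd p i))) ≫ μ[H]

/-- Families of morphisms `αᵢ : D' ⊗ D ⟶ D`, `βᵢ : D' ⊗ D ⟶ D'`, one pair for each of the `n - 1`
pairs of brackets `(D ⊗ D')` of the bracketing. -/
def Actions : {n : ℕ} → Bracketing n → (Fin n → C) → Type v
  | _, single, _ => PUnit
  | _, pair (p := p) (q := q) s t, A =>
      let D := obj s (fun i => A (Fin.castAdd q i))
      let D' := obj t (fun i => A (Fin.natAdd p i))
      (Actions s (fun i => A (Fin.castAdd q i)) × Actions t (fun i => A (Fin.natAdd p i))) ×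
        ((D' ⊗ D ⟶ D) × (D' ⊗ D ⟶ D'))

/-- The bialgebra structure `S` on the bracketed tensor product is the iterated double cross product
`σ(A₁ ⋈ A₂ ⋈ ⋯ ⋈ Aₙ)` along the actions `act`: for every pair of brackets the double cross product
of its two parts is formed, and is a bialgebra. -/
def IsIteratedDoubleCross : {n : ℕ} → (σ : Bracketing n) → (A : Fin n → C) →
    (∀ i, BimonObj (A i)) → σ.Actions A → BimonObj (σ.obj A) → Prop
  | _, single, _, bi, _, S => S = bi 0
  | _, pair (p := p) (q := q) s t, A, bi, act, S =>
      ∃ (S₁ : BimonObj (s.obj (fun i => A (Fin.castAdd q i))))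
        (S₂ : BimonObj (t.obj (fun i => A (Fin.natAdd p i)))),
        IsIteratedDoubleCross s _ (fun i => bi (Fin.castAdd q i)) act.1.1 S₁ ∧
        IsIteratedDoubleCross t _ (fun i => bi (Fin.natAdd p i)) act.1.2 S₂ ∧
        IsDoubleCrossProduct _ _ act.2.1 act.2.2 S

/-- The Hopf algebra version of `IsIteratedDoubleCross`: all double cross products that are formed
are Hopf algebras. -/
def IsIteratedHopfDoubleCross : {n : ℕ} → (σ : Bracketing n) → (A : Fin n → C) →
    (∀ i, HopfObj (A i)) → σ.Actions A → HopfObj (σ.obj A) → Prop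
  | _, single, _, ho, _, S => S = ho 0
  | _, pair (p := p) (q := q) s t, A, ho, act, S =>
      ∃ (S₁ : HopfObj (s.obj (fun i => A (Fin.castAdd q i))))
        (S₂ : HopfObj (t.obj (fun i => A (Fin.natAdd p i)))),
        IsIteratedHopfDoubleCross s _ (fun i => ho (Fin.castAdd q i)) act.1.1 S₁ ∧
        IsIteratedHopfDoubleCross t _ (fun i => ho (Fin.natAdd p i)) act.1.2 S₂ ∧
        IsDoubleCrossProduct _ _ act.2.1 act.2.2 S.toBimonObj

end Bracketing

end DoubleCross

section Factorization

variable {k : Type w} [Field k] {C : Type u} [Category.{v} C] [MonoidalCategory C]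
  [BraidedCategory C] (F : C ⥤ ModuleCat.{w} k)

/-- The product `PQ` of two subspaces of the underlying vector space of an algebra `H` of `C`: the
span of the products `x y`, `x ∈ P`, `y ∈ Q`. Here `F` sends an object to its underlying vector
space. -/
def mulSubspace [F.Monoidal] (H : C) [MonObj H] (P Q : Submodule k (F.obj H)) :
    Submodule k (F.obj H) :=
  Submodule.span k {z | ∃ x ∈ P, ∃ y ∈ Q,
    z = (Functor.LaxMonoidal.μ F H H ≫ F.map μ[H]).hom (TensorProduct.tmul k x y)}

/-- The subspace `j₁(A₁) j₂(A₂) ⋯ jₙ(Aₙ)` of `H`. -/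
def Bracketing.prodImage [F.Monoidal] {H : C} [MonObj H] : {n : ℕ} → Bracketing n →
    (A : Fin n → C) → (∀ i, A i ⟶ H) → Submodule k (F.obj H)
  | _, .single, _, j => LinearMap.range (F.map (j 0)).hom
  | _, .pair (p := p) (q := q) s t, A, j =>
      mulSubspace F H
        (prodImage s (fun i => A (Fin.castAdd q i)) (fun i => j (Fin.castAdd q i)))
        (prodImage t (fun i => A (Fin.natAdd p i)) (fun i => j (Fin.natAdd p i)))

/-- The subspace `P` of `H` is the underlying space of a sub-bialgebra of `H` in `C`: a bialgebra
with an injective bialgebra morphism to `H` whose image is `P`. -/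
structure SubBialgebra (H : C) [BimonObj H] (P : Submodule k (F.obj H)) where
  carrier : C
  bimon : BimonObj carrier
  incl : carrier ⟶ H
  isBimonHom : IsBimonHom incl
  injective : Function.Injective (F.map incl).hom
  range_eq : LinearMap.range (F.map incl).hom = P

/-- The subspace `P` of `H` is the underlying space of a sub-Hopf algebra of `H` in `C`: a Hopf
algebra with an injective morphism to `H` whose image is `P`. (A bialgebra morphism between Hopf
algebras commutes with the antipodes.) -/
structure SubHopfAlgebra (H : C) [HopfObj H] (P : Submodule k (F.obj H)) where
  carrier : C
  hopf : HopfObj carrier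
  incl : carrier ⟶ H
  isBimonHom : IsBimonHom incl
  injective : Function.Injective (F.map incl).hom
  range_eq : LinearMap.range (F.map incl).hom = P

/-- `f : X ⟶ H` is, in `C`, a bijective map onto the subobject `incl : B ⟶ H`. -/
def IsBijectiveOnto {X B H : C} (f : X ⟶ H) (incl : B ⟶ H) : Prop :=
  ∃ e : X ⟶ B, e ≫ incl = f ∧ Function.Bijective (F.map e).hom

/-- For every pair of brackets, the product of the images of the factors in it is a sub-bialgebra
of `H`, and the iterated multiplication is a bijective map from the tensor product of these factors
onto it. -/
def Bracketing.BracketsFactor [F.Monoidal] {H : C} [BimonObj H] : {n : ℕ} → (σ : Bracketing n) →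
    (A : Fin n → C) → (∀ i, A i ⟶ H) → Prop
  | _, .single, _, _ => True
  | _, .pair (p := p) (q := q) s t, A, j =>
      (∃ B : SubBialgebra F H ((s.pair t).prodImage F A j),
        IsBijectiveOnto F ((s.pair t).iterMul A j) B.incl) ∧
      BracketsFactor s (fun i => A (Fin.castAdd q i)) (fun i => j (Fin.castAdd q i)) ∧
      BracketsFactor t (fun i => A (Fin.natAdd p i)) (fun i => j (Fin.natAdd p i))

/-- The Hopf algebra version of `BracketsFactor`. -/
def Bracketing.BracketsHopfFactor [F.Monoidal] {H : C} [HopfObj H] : {n : ℕ} →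
    (σ : Bracketing n) → (A : Fin n → C) → (∀ i, A i ⟶ H) → Prop
  | _, .single, _, _ => True
  | _, .pair (p := p) (q := q) s t, A, j =>
      (∃ B : SubHopfAlgebra F H ((s.pair t).prodImage F A j),
        IsBijectiveOnto F ((s.pair t).iterMul A j) B.incl) ∧
      BracketsHopfFactor s (fun i => A (Fin.castAdd q i)) (fun i => j (Fin.castAdd q i)) ∧
      BracketsHopfFactor t (fun i => A (Fin.natAdd p i)) (fun i => j (Fin.natAdd p i))

/-- The bialgebra morphisms `jᵢ : Aᵢ ⟶ H` form a double factorization of the bialgebra `H` with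
respect to `σ`. -/
structure IsDoubleFactorization [F.Monoidal] {n : ℕ} (σ : Bracketing n) (A : Fin n → C)
    [∀ i, BimonObj (A i)] (H : C) [BimonObj H] (j : ∀ i, A i ⟶ H) : Prop where
  isBimonHom : ∀ i, IsBimonHom (j i)
  prod_eq_top : σ.prodImage F A j = ⊤
  brackets : σ.BracketsFactor F A j

/-- The Hopf algebra morphisms `jᵢ : Aᵢ ⟶ H` form a double factorization of the Hopf algebra `H`
with respect to `σ`. -/
structure IsHopfDoubleFactorization [F.Monoidal] {n : ℕ} (σ : Bracketing n) (A : Fin n → C)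
    [∀ i, HopfObj (A i)] (H : C) [HopfObj H] (j : ∀ i, A i ⟶ H) : Prop where
  isBimonHom : ∀ i, IsBimonHom (j i)
  prod_eq_top : σ.prodImage F A j = ⊤
  brackets : σ.BracketsHopfFactor F A j

end Factorization

end BraidedFactorization

/-!
Consider first two bialgebra morphisms `i : A ⟶ K` and `j : D ⟶ K` for which the product
`prodMap i j : A ⊗ D ⟶ K`, `a ⊗ d ↦ i a * j d`, is invertible. Rewriting `j d * i a` in the form
`i a' * j d'` gives a morphism `exchange i j : D ⊗ A ⟶ A ⊗ D`. Multiplication of a bialgebra is a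
morphism of coalgebras, hence so are `prodMap i j` and `exchange i j`. The actions `leftAct` and
`rightAct` are the two components of `exchange i j`, obtained with the counits. They are morphisms
of coalgebras, and `exchange i j` is recovered from them with the comultiplication of `D ⊗ A`
(`comul_components`). Associativity in `K` says how `exchange i j` behaves on products in `D` and in
`A` (`mul_exchange`, `exchange_mul`), and applying a counit yields the module axioms. As
`(a d) (a' d') = a (d a') d'`, the multiplication of `K` transported along `prodMap i j` is that of
the double cross product (`crossMul_prodMap`, `isDoubleCrossProduct_bimonOfIso`).

The theorem follows by induction on the bracketing. For a pair of brackets with sub-bialgebra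
`incl : K ⟶ H`, the iterated products `f : A ⟶ H`, `g : D ⟶ H` of its two parts are bialgebra
morphisms by induction. Their product factors as `e ≫ incl` with `e` invertible, since the functor
to vector spaces reflects isomorphisms. Composing `e` with the units of `D` and `A` lifts `f` and `g`
to morphisms `i`, `j` into `K` with `prodMap i j = e` (`exists_lift_of_prodMap`). They are bialgebra
morphisms because `incl` and `incl ⊗ incl` are monomorphisms, the functor being faithful and vector
spaces flat. So the case of two factors applies to `i` and `j`. For Hopf algebras the antipode is
transported as well, and bialgebra morphisms commute with antipodes.
-/

namespace BraidedFactorization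

/-! ### Tensor products of coalgebras and their projections -/

section Coalgebras

variable {C : Type u} [Category.{v} C] [MonoidalCategory C] [BraidedCategory C]

instance isComonHom_tensorHom {X Y X' Y' : C} [ComonObj X] [ComonObj Y] [ComonObj X'] [ComonObj Y']
    (f : X ⟶ X') (g : Y ⟶ Y') [IsComonHom f] [IsComonHom g] : IsComonHom (f ⊗ₘ g) where
  hom_counit := by simp [tensorHom_comp_tensorHom_assoc]
  hom_comul := by
    simp only [Comon.tensorObj_comul, Category.assoc, ← tensorμ_natural,
      tensorHom_comp_tensorHom_assoc, IsComonHom.hom_comul]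

instance isComonHom_mul (H : C) [BimonObj H] : IsComonHom μ[H] where
  hom_counit := BimonObj.mul_counit H
  hom_comul := by simp

/-- The projection `A ⊗ D ⟶ A` of a tensor product of coalgebras, given by the counit of `D`. -/
def tensorFst (A D : C) [ComonObj D] : A ⊗ D ⟶ A := A ◁ ε[D] ≫ (ρ_ A).hom

/-- The projection `A ⊗ D ⟶ D` of a tensor product of coalgebras, given by the counit of `A`. -/
def tensorSnd (A D : C) [ComonObj A] : A ⊗ D ⟶ D := ε[A] ▷ D ≫ (λ_ D).hom

instance isComonHom_tensorFst (A D : C) [ComonObj A] [ComonObj D] :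
    IsComonHom (tensorFst A D) where
  hom_counit := by
    simp [tensorFst, MonoidalCategory.tensorHom_def', unitors_equal]
  hom_comul := by
    have hε : Δ[D] ≫ (ε[D] ⊗ₘ ε[D]) = ε[D] ≫ (λ_ (𝟙_ C)).inv := by simp [unitors_inv_equal]
    have h := tensorμ_natural (𝟙 A) (𝟙 A) ε[D] ε[D]
    simp only [Comon.tensorObj_comul, tensorFst, Category.assoc, ← tensorHom_comp_tensorHom]
    simp only [← id_tensorHom, ← reassoc_of% h, id_tensorHom_id]
    rw [tensorHom_comp_tensorHom_assoc, hε, Category.comp_id, ← Category.id_comp Δ[A],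
      ← tensorHom_comp_tensorHom_assoc, MonoidalCategory.tensorHom_def Δ[A], Category.assoc,
      ← tensor_right_unitality, rightUnitor_naturality, Category.id_comp]

instance isComonHom_tensorSnd (A D : C) [ComonObj A] [ComonObj D] :
    IsComonHom (tensorSnd A D) where
  hom_counit := by
    simp [tensorSnd, MonoidalCategory.tensorHom_def, -Iso.cancel_iso_hom_right]
  hom_comul := by
    have hε : Δ[A] ≫ (ε[A] ⊗ₘ ε[A]) = ε[A] ≫ (λ_ (𝟙_ C)).inv := by simp [unitors_inv_equal]
    have h := tensorμ_natural ε[A] ε[A] (𝟙 D) (𝟙 D)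
    simp only [Comon.tensorObj_comul, tensorSnd, Category.assoc, ← tensorHom_comp_tensorHom]
    simp only [← tensorHom_id, ← reassoc_of% h, id_tensorHom_id]
    rw [tensorHom_comp_tensorHom_assoc, hε, Category.comp_id, ← Category.id_comp Δ[D],
      ← tensorHom_comp_tensorHom_assoc, MonoidalCategory.tensorHom_def' _ Δ[D], Category.assoc,
      ← tensor_left_unitality, leftUnitor_naturality, Category.id_comp]

/-- The identity of `A ⊗ D` is recovered from its two projections. -/
theorem comul_tensorFst_tensorSnd (A D : C) [ComonObj A] [ComonObj D] :
    Δ[A ⊗ D] ≫ (tensorFst A D ⊗ₘ tensorSnd A D) = 𝟙 (A ⊗ D) := by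
  have h := tensorμ_natural (𝟙 A) ε[A] ε[D] (𝟙 D)
  simp only [Comon.tensorObj_comul, tensorFst, tensorSnd, Category.assoc,
    ← tensorHom_comp_tensorHom]
  simp only [← id_tensorHom, ← tensorHom_id, ← reassoc_of% h]
  rw [tensorHom_comp_tensorHom_assoc]
  simp only [id_tensorHom, tensorHom_id, ComonObj.comul_counit, ComonObj.counit_comul]
  have h2 : tensorμ A (𝟙_ C) (𝟙_ C) D = ((ρ_ A).hom ⊗ₘ (λ_ D).hom) ≫ ((ρ_ A).inv ⊗ₘ (λ_ D).inv) := by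
    simp only [tensorμ, braiding_tensorUnit_left]
    monoidal
  rw [h2]
  simp [tensorHom_comp_tensorHom]

/-- A coalgebra morphism into `A ⊗ D` is determined by its two components. -/
theorem comul_components {X A D : C} [ComonObj X] [ComonObj A] [ComonObj D] (f : X ⟶ A ⊗ D)
    [IsComonHom f] :
    Δ[X] ≫ ((f ≫ tensorFst A D) ⊗ₘ (f ≫ tensorSnd A D)) = f := by
  rw [← tensorHom_comp_tensorHom, ← IsComonHom.hom_comul_assoc, comul_tensorFst_tensorSnd,
    Category.comp_id]

end Coalgebras

/-! ### Products of morphisms into an algebra -/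

section Products

variable {C : Type u} [Category.{v} C] [MonoidalCategory C]

/-- The product `x ⊗ y ↦ f x * g y` of two morphisms into an algebra. -/
def prodMap {X Y K : C} [MonObj K] (f : X ⟶ K) (g : Y ⟶ K) : X ⊗ Y ⟶ K := (f ⊗ₘ g) ≫ μ[K]

variable {X Y Z K : C} [MonObj K]

theorem tensorHom_prodMap {X' Y' : C} (u : X' ⟶ X) (v : Y' ⟶ Y) (f : X ⟶ K) (g : Y ⟶ K) :
    (u ⊗ₘ v) ≫ prodMap f g = prodMap (u ≫ f) (v ≫ g) := by
  simp [prodMap, tensorHom_comp_tensorHom_assoc]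

theorem whiskerRight_prodMap {X' : C} (u : X' ⟶ X) (f : X ⟶ K) (g : Y ⟶ K) :
    u ▷ Y ≫ prodMap f g = prodMap (u ≫ f) g := by
  simp [← tensorHom_id, tensorHom_prodMap]

theorem whiskerLeft_prodMap {Y' : C} (v : Y' ⟶ Y) (f : X ⟶ K) (g : Y ⟶ K) :
    X ◁ v ≫ prodMap f g = prodMap f (v ≫ g) := by
  simp [← id_tensorHom, tensorHom_prodMap]

theorem associator_hom_prodMap (f : X ⟶ K) (g : Y ⟶ K) (h : Z ⟶ K) :
    (α_ X Y Z).hom ≫ prodMap f (prodMap g h) = prodMap (prodMap f g) h := by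
  have h₁ : (f ⊗ₘ g) ≫ μ[K] ⊗ₘ h = ((f ⊗ₘ g) ⊗ₘ h) ≫ μ[K] ▷ K := by
    rw [← tensorHom_id, tensorHom_comp_tensorHom, Category.comp_id]
  have h₂ : f ⊗ₘ (g ⊗ₘ h) ≫ μ[K] = (f ⊗ₘ (g ⊗ₘ h)) ≫ K ◁ μ[K] := by
    rw [← id_tensorHom, tensorHom_comp_tensorHom, Category.comp_id]
  simp only [prodMap, h₁, h₂, Category.assoc, MonObj.mul_assoc, associator_naturality_assoc]

theorem associator_inv_prodMap (f : X ⟶ K) (g : Y ⟶ K) (h : Z ⟶ K) :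
    (α_ X Y Z).inv ≫ prodMap (prodMap f g) h = prodMap f (prodMap g h) := by
  rw [← associator_hom_prodMap, Iso.inv_hom_id_assoc]

theorem prodMap_comp {L : C} [MonObj L] (f : X ⟶ K) (g : Y ⟶ K) (h : K ⟶ L) [IsMonHom h] :
    prodMap f g ≫ h = prodMap (f ≫ h) (g ≫ h) := by
  simp [prodMap, tensorHom_comp_tensorHom_assoc]

theorem mul_comp (i : X ⟶ K) [MonObj X] [IsMonHom i] : μ[X] ≫ i = prodMap i i :=
  IsMonHom.mul_hom i

theorem one_prodMap (g : Y ⟶ K) : prodMap η[K] g = (λ_ Y).hom ≫ g := MonObj.one_mul_hom g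

theorem prodMap_one (f : X ⟶ K) : prodMap f η[K] = (ρ_ X).hom ≫ f := MonObj.mul_one_hom f

end Products

instance isComonHom_prodMap {C : Type u} [Category.{v} C] [MonoidalCategory C] [BraidedCategory C]
    {X Y K : C} [ComonObj X] [ComonObj Y] [BimonObj K] (f : X ⟶ K) (g : Y ⟶ K) [IsComonHom f]
    [IsComonHom g] : IsComonHom (prodMap f g) :=
  inferInstanceAs (IsComonHom ((f ⊗ₘ g) ≫ μ[K]))

/-! ### Exchanging the two factors of a factorization -/

section Exchange

variable {C : Type u} [Category.{v} C] [MonoidalCategory C] {A D K : C} [MonObj K]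
  (i : A ⟶ K) (j : D ⟶ K) [IsIso (prodMap i j)]

/-- When multiplication `A ⊗ D ⟶ K` is an isomorphism, the morphism `D ⊗ A ⟶ A ⊗ D` that rewrites
a product `d a` in `K` as a combination of products `a' d'`. -/
noncomputable def exchange : D ⊗ A ⟶ A ⊗ D := prodMap j i ≫ inv (prodMap i j)

theorem exchange_prodMap : exchange i j ≫ prodMap i j = prodMap j i := by
  simp [exchange]

/-- The compatibilities of `exchange` with units and multiplications hold because both sides agree
after multiplying out in `K`. -/
theorem one_exchange [MonObj D] [IsMonHom j] :
    η[D] ▷ A ≫ exchange i j = (λ_ A).hom ≫ (ρ_ A).inv ≫ A ◁ η[D] := by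
  rw [← cancel_mono (prodMap i j)]
  simp [exchange_prodMap, whiskerRight_prodMap, whiskerLeft_prodMap, one_prodMap, prodMap_one]

theorem exchange_one [MonObj A] [IsMonHom i] :
    D ◁ η[A] ≫ exchange i j = (ρ_ D).hom ≫ (λ_ D).inv ≫ η[A] ▷ D := by
  rw [← cancel_mono (prodMap i j)]
  simp [exchange_prodMap, whiskerRight_prodMap, whiskerLeft_prodMap, one_prodMap, prodMap_one]

theorem mul_exchange [MonObj D] [IsMonHom j] : μ[D] ▷ A ≫ exchange i j =
    (α_ D D A).hom ≫ D ◁ exchange i j ≫ (α_ D A D).inv ≫ exchange i j ▷ D ≫ (α_ A D D).hom ≫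
      A ◁ μ[D] := by
  rw [← cancel_mono (prodMap i j)]
  simp only [Category.assoc, exchange_prodMap, whiskerRight_prodMap, whiskerLeft_prodMap, mul_comp,
    associator_hom_prodMap, associator_inv_prodMap]

theorem exchange_mul [MonObj A] [IsMonHom i] : D ◁ μ[A] ≫ exchange i j =
    (α_ D A A).inv ≫ exchange i j ▷ A ≫ (α_ A D A).hom ≫ A ◁ exchange i j ≫ (α_ A A D).inv ≫
      μ[A] ▷ D := by
  rw [← cancel_mono (prodMap i j)]
  simp only [Category.assoc, exchange_prodMap, whiskerRight_prodMap, whiskerLeft_prodMap, mul_comp,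
    associator_hom_prodMap, associator_inv_prodMap]

end Exchange

/-! ### The double cross product of a factorization into two factors -/

section TwoFactors

variable {C : Type u} [Category.{v} C] [MonoidalCategory C] [BraidedCategory C]

/-- The bialgebra structure on a coalgebra `X` whose multiplication and unit are transported along
an invertible coalgebra morphism `f` from `X` to a bialgebra `K`. -/
@[reducible]
noncomputable def bimonOfIso {X K : C} [ComonObj X] [BimonObj K] (f : X ⟶ K) [IsIso f]
    [IsComonHom f] : BimonObj X where
  toMonObj := MonObj.ofIso (asIso f).symm
  toComonObj := inferInstance
  mul_comul := by
    simp [MonObj.ofIso_mul]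
  mul_counit := by
    simp [MonObj.ofIso_mul]
  one_comul := by
    simp [MonObj.ofIso_one, MonObj.tensorObj.one_def, tensorHom_comp_tensorHom]
  one_counit := by
    simp [MonObj.ofIso_one]

theorem isBimonHom_bimonOfIso {X K : C} [ComonObj X] [BimonObj K] (f : X ⟶ K) [IsIso f]
    [IsComonHom f] : @IsBimonHom _ _ _ _ X K (bimonOfIso f) _ f :=
  letI := bimonOfIso f
  { one_hom := by simp [MonObj.ofIso_one]
    mul_hom := by simp [MonObj.ofIso_mul]
    hom_counit := IsComonHom.hom_counit f
    hom_comul := IsComonHom.hom_comul f }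

/-- The Hopf algebra version of `bimonOfIso`. -/
@[reducible]
noncomputable def hopfOfIso {X K : C} [ComonObj X] [HopfObj K] (f : X ⟶ K) [IsIso f]
    [IsComonHom f] : HopfObj X where
  toBimonObj := bimonOfIso f
  antipode := f ≫ HopfObj.antipode ≫ inv f
  antipode_left := by
    have h : (f ≫ HopfObj.antipode ≫ inv f) ▷ X ≫ (f ⊗ₘ f) =
        (f ⊗ₘ f) ≫ HopfObj.antipode ▷ K := by
      simp [← tensorHom_id, tensorHom_comp_tensorHom]
    change Δ[X] ≫ _ ≫ (f ⊗ₘ f) ≫ μ[K] ≫ inv f = ε[X] ≫ η[K] ≫ inv f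
    rw [reassoc_of% h, ← IsComonHom.hom_comul_assoc, HopfObj.antipode_left_assoc,
      IsComonHom.hom_counit_assoc]
  antipode_right := by
    have h : X ◁ (f ≫ HopfObj.antipode ≫ inv f) ≫ (f ⊗ₘ f) =
        (f ⊗ₘ f) ≫ K ◁ HopfObj.antipode := by
      simp [← id_tensorHom, tensorHom_comp_tensorHom]
    change Δ[X] ≫ _ ≫ (f ⊗ₘ f) ≫ μ[K] ≫ inv f = ε[X] ≫ η[K] ≫ inv f
    rw [reassoc_of% h, ← IsComonHom.hom_comul_assoc, HopfObj.antipode_right_assoc,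
      IsComonHom.hom_counit_assoc]

instance {A D K : C} [ComonObj A] [ComonObj D] [BimonObj K] (i : A ⟶ K) (j : D ⟶ K)
    [IsIso (prodMap i j)] [IsComonHom i] [IsComonHom j] : IsComonHom (exchange i j) :=
  inferInstanceAs (IsComonHom (prodMap j i ≫ inv (prodMap i j)))

variable {A D K : C} [BimonObj A] [BimonObj D] [BimonObj K] (i : A ⟶ K) (j : D ⟶ K)
  [IsIso (prodMap i j)]

/-- The left action `D ⊗ A ⟶ A` of a factorization: the first component of `exchange`. -/
noncomputable def leftAct : D ⊗ A ⟶ A := exchange i j ≫ tensorFst A D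

/-- The right action `D ⊗ A ⟶ D` of a factorization: the second component of `exchange`. -/
noncomputable def rightAct : D ⊗ A ⟶ D := exchange i j ≫ tensorSnd A D

variable [IsBimonHom i] [IsBimonHom j]

instance : IsComonHom (leftAct i j) :=
  inferInstanceAs (IsComonHom (exchange i j ≫ tensorFst A D))

instance : IsComonHom (rightAct i j) :=
  inferInstanceAs (IsComonHom (exchange i j ≫ tensorSnd A D))

/-- The middle factor of `crossMul` is `exchange`, as this is a morphism of coalgebras. -/
theorem comul_leftAct_rightAct :
    (Δ[D] ⊗ₘ Δ[A]) ≫ tensorμ D D A A ≫ (leftAct i j ⊗ₘ rightAct i j) = exchange i j := by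
  rw [leftAct, rightAct, ← Category.assoc, ← Comon.tensorObj_comul, comul_components]

theorem isLeftModuleCoalgebra_leftAct : IsLeftModuleCoalgebra D A (leftAct i j) where
  one_act := by
    rw [leftAct, reassoc_of% one_exchange i j, tensorFst, ← MonoidalCategory.whiskerLeft_comp_assoc,
      BimonObj.one_counit]
    simp
  mul_act := by
    -- Discarding the `D` component of `mul_exchange` leaves the `A` components of both exchanges.
    have h : A ◁ μ[D] ≫ tensorFst A D = (α_ A D D).inv ≫ tensorFst (A ⊗ D) D ≫ tensorFst A D := by
      simp only [tensorFst, ← MonoidalCategory.whiskerLeft_comp_assoc, BimonObj.mul_counit]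
      simp [MonoidalCategory.tensorHom_def', unitors_equal]
    have h' : exchange i j ▷ D ≫ tensorFst (A ⊗ D) D = tensorFst (D ⊗ A) D ≫ exchange i j := by
      rw [tensorFst, tensorFst, ← whisker_exchange_assoc, rightUnitor_naturality, Category.assoc]
    have h'' : (α_ D A D).inv ≫ tensorFst (D ⊗ A) D = D ◁ tensorFst A D := by
      simp [tensorFst]
    simp only [leftAct, reassoc_of% mul_exchange i j, h, Iso.hom_inv_id_assoc, reassoc_of% h',
      reassoc_of% h'', MonoidalCategory.whiskerLeft_comp, Category.assoc]
  act_comul := by simp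
  act_counit := by simp

theorem isRightModuleCoalgebra_rightAct : IsRightModuleCoalgebra D A (rightAct i j) where
  act_one := by
    rw [rightAct, reassoc_of% exchange_one i j, tensorSnd, ← comp_whiskerRight_assoc,
      BimonObj.one_counit]
    simp
  act_mul := by
    have h : μ[A] ▷ D ≫ tensorSnd A D = (α_ A A D).hom ≫ tensorSnd A (A ⊗ D) ≫ tensorSnd A D := by
      simp only [tensorSnd, ← comp_whiskerRight_assoc, BimonObj.mul_counit]
      simp [MonoidalCategory.tensorHom_def]
    have h' : A ◁ exchange i j ≫ tensorSnd A (A ⊗ D) = tensorSnd A (D ⊗ A) ≫ exchange i j := by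
      rw [tensorSnd, tensorSnd, whisker_exchange_assoc, leftUnitor_naturality, Category.assoc]
    have h'' : (α_ A D A).hom ≫ tensorSnd A (D ⊗ A) = tensorSnd A D ▷ A := by
      simp [tensorSnd]
    simp only [rightAct, reassoc_of% exchange_mul i j, h, Iso.inv_hom_id_assoc, reassoc_of% h',
      reassoc_of% h'', comp_whiskerRight, Category.assoc]
  act_comul := by simp
  act_counit := by simp

/-- In `K`, one has `(a d) (a' d') = a (d a') d'`; exchanging `d` and `a'` gives the multiplication
of the double cross product. -/
theorem crossMul_prodMap :
    crossMul A D (leftAct i j) (rightAct i j) ≫ prodMap i j =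
      prodMap (prodMap i j) (prodMap i j) := by
  have h : (μ[A] ⊗ₘ μ[D]) ≫ prodMap i j = prodMap (prodMap i i) (prodMap j j) := by
    rw [tensorHom_prodMap, mul_comp, mul_comp]
  simp only [crossMul, Category.assoc, comul_leftAct_rightAct, h, associator_inv_prodMap]
  simp only [← MonoidalCategory.whiskerLeft_comp_assoc]
  rw [whiskerLeft_prodMap]
  simp only [Category.assoc, associator_hom_prodMap, whiskerRight_prodMap, exchange_prodMap,
    associator_inv_prodMap]

theorem isDoubleCrossProduct_bimonOfIso :
    IsDoubleCrossProduct A D (leftAct i j) (rightAct i j) (bimonOfIso (prodMap i j)) where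
  left_module := isLeftModuleCoalgebra_leftAct i j
  right_module := isRightModuleCoalgebra_rightAct i j
  mul_eq := by
    rw [← cancel_mono (prodMap i j), crossMul_prodMap]
    change (((prodMap i j) ⊗ₘ (prodMap i j)) ≫ μ[K] ≫ inv (prodMap i j)) ≫ prodMap i j = _
    simp [prodMap]
  one_eq := by
    rw [← cancel_mono (prodMap i j), Category.assoc, tensorHom_prodMap, IsMonHom.one_hom i,
      IsMonHom.one_hom j, one_prodMap]
    simp [MonObj.ofIso_one]
  comul_eq := Comon.tensorObj_comul A D
  counit_eq := Comon.tensorObj_counit A D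

end TwoFactors

/-! ### Lifting a factorization to a sub-bialgebra -/

section Lift

variable {C : Type u} [Category.{v} C] [MonoidalCategory C] [BraidedCategory C]

theorem isBimonHom_comp {X Y Z : C} [BimonObj X] [BimonObj Y] [BimonObj Z] (f : X ⟶ Y) (g : Y ⟶ Z)
    [IsBimonHom f] [IsBimonHom g] : IsBimonHom (f ≫ g) where
  toIsMonHom := inferInstance
  toIsComonHom := inferInstance

/-- Only the compatibility with comultiplication needs `incl ⊗ incl` to be a monomorphism. -/
theorem isBimonHom_of_comp {X K H : C} [BimonObj X] [BimonObj K] [BimonObj H] (g : X ⟶ K)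
    (incl : K ⟶ H) [IsBimonHom incl] [Mono incl] [Mono (incl ⊗ₘ incl)] [IsBimonHom (g ≫ incl)] :
    IsBimonHom g where
  one_hom := by
    rw [← cancel_mono incl, Category.assoc, IsMonHom.one_hom, IsMonHom.one_hom]
  mul_hom := by
    rw [← cancel_mono incl, Category.assoc, IsMonHom.mul_hom, Category.assoc, IsMonHom.mul_hom,
      tensorHom_comp_tensorHom_assoc]
  hom_counit := by
    rw [← IsComonHom.hom_counit incl, ← Category.assoc, IsComonHom.hom_counit]
  hom_comul := by
    rw [← cancel_mono (incl ⊗ₘ incl), Category.assoc, ← IsComonHom.hom_comul, ← Category.assoc,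
      IsComonHom.hom_comul, Category.assoc, tensorHom_comp_tensorHom]

/-- If the product of two bialgebra morphisms `f`, `g` into `H` factors through a sub-bialgebra `K`,
then so do `f` and `g`, by bialgebra morphisms whose product is the given factorization. -/
theorem exists_lift_of_prodMap {A D K H : C} [BimonObj A] [BimonObj D] [BimonObj K] [BimonObj H]
    (f : A ⟶ H) (g : D ⟶ H) [IsBimonHom f] [IsBimonHom g] (incl : K ⟶ H) [IsBimonHom incl]
    [Mono incl] [Mono (incl ⊗ₘ incl)] (e : A ⊗ D ⟶ K) (he : e ≫ incl = prodMap f g) :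
    ∃ (i : A ⟶ K) (j : D ⟶ K), IsBimonHom i ∧ IsBimonHom j ∧ prodMap i j = e := by
  -- `f` and `g` are recovered from their product by multiplying with the unit.
  have hf : ((ρ_ A).inv ≫ A ◁ η[D] ≫ e) ≫ incl = f := by
    simp [he, whiskerLeft_prodMap, prodMap_one]
  have hg : ((λ_ D).inv ≫ η[A] ▷ D ≫ e) ≫ incl = g := by
    simp [he, whiskerRight_prodMap, one_prodMap]
  refine ⟨(ρ_ A).inv ≫ A ◁ η[D] ≫ e, (λ_ D).inv ≫ η[A] ▷ D ≫ e, ?_, ?_, ?_⟩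
  · have : IsBimonHom (((ρ_ A).inv ≫ A ◁ η[D] ≫ e) ≫ incl) := by rwa [hf]
    exact isBimonHom_of_comp _ incl
  · have : IsBimonHom (((λ_ D).inv ≫ η[A] ▷ D ≫ e) ≫ incl) := by rwa [hg]
    exact isBimonHom_of_comp _ incl
  · rw [← cancel_mono incl, prodMap_comp, hf, hg, he]

end Lift

/-! ### Factorizations in a category concrete over vector spaces -/

section Concrete

variable {k : Type w} [Field k] {C : Type u} [Category.{v} C] (F : C ⥤ ModuleCat.{w} k)

theorem mono_of_injective [F.Faithful] {X Y : C} (f : X ⟶ Y)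
    (hf : Function.Injective (F.map f).hom) : Mono f :=
  F.mono_of_mono_map ((ModuleCat.mono_iff_injective _).2 hf)

theorem isIso_of_bijective [F.ReflectsIsomorphisms] {X Y : C} (f : X ⟶ Y)
    (hf : Function.Bijective (F.map f).hom) : IsIso f :=
  have : IsIso (F.map f) := (ConcreteCategory.isIso_iff_bijective _).2 hf
  isIso_of_reflects_iso f F

/-- A bijection onto a subobject whose underlying space is everything is an isomorphism. -/
theorem isIso_of_isBijectiveOnto [F.ReflectsIsomorphisms] {X B H : C} {f : X ⟶ H} {incl : B ⟶ H}
    (h : IsBijectiveOnto F f incl) (hinj : Function.Injective (F.map incl).hom)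
    (hrange : LinearMap.range (F.map incl).hom = ⊤) : IsIso f := by
  obtain ⟨e, rfl, he⟩ := h
  have := isIso_of_bijective F e he
  have := isIso_of_bijective F incl ⟨hinj, LinearMap.range_eq_top.1 hrange⟩
  infer_instance

variable [MonoidalCategory C] [F.Monoidal]

/-- Over a field the tensor product of two injective linear maps is injective. -/
theorem mono_tensorHom_of_injective [F.Faithful] {X Y X' Y' : C} (f : X ⟶ X') (g : Y ⟶ Y')
    (hf : Function.Injective (F.map f).hom) (hg : Function.Injective (F.map g).hom) :
    Mono (f ⊗ₘ g) := by
  have : Mono (F.map f ⊗ₘ F.map g) :=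
    (ModuleCat.mono_iff_injective _).2 (TensorProduct.map_injective_of_flat_flat _ _ hf hg)
  refine F.mono_of_mono_map ?_
  rw [Functor.Monoidal.map_tensor]
  infer_instance

variable [BraidedCategory C] [F.Faithful] [F.ReflectsIsomorphisms]

/-- The pairs of brackets glue together: if each of the two parts already carries a bialgebra
structure for which its map to `H` is a bialgebra morphism, and the product of the two maps is a
bijection onto a sub-bialgebra `incl : K ⟶ H`, then that product comes from a factorization
of `K`. -/
theorem exists_factorization {A D K H : C} [BimonObj A] [BimonObj D] [BimonObj K] [BimonObj H]
    (f : A ⟶ H) (g : D ⟶ H) [IsBimonHom f] [IsBimonHom g] (incl : K ⟶ H) [IsBimonHom incl]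
    (hincl : Function.Injective (F.map incl).hom)
    (h : IsBijectiveOnto F (prodMap f g) incl) :
    ∃ (i : A ⟶ K) (j : D ⟶ K), IsBimonHom i ∧ IsBimonHom j ∧ IsIso (prodMap i j) ∧
      prodMap i j ≫ incl = prodMap f g := by
  obtain ⟨e, he, hbij⟩ := h
  have := mono_of_injective F incl hincl
  have := mono_tensorHom_of_injective F incl incl hincl hincl
  obtain ⟨i, j, hi, hj, rfl⟩ := exists_lift_of_prodMap f g incl e he
  exact ⟨i, j, hi, hj, isIso_of_bijective F _ hbij, he⟩

/-- The induction over the bracketing. The maps to `H` of the two parts of a pair of brackets need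
not be assumed injective: that they factor through the sub-bialgebra of the pair follows from the
factorization of their product. -/
theorem exists_isIteratedDoubleCross {n : ℕ} (σ : Bracketing n) (A : Fin n → C)
    (bi : ∀ i, BimonObj (A i)) (H : C) [BimonObj H] (j : ∀ i, A i ⟶ H)
    (hj : ∀ i, IsBimonHom (j i)) (hσ : σ.BracketsFactor F A j) :
    ∃ (act : σ.Actions A) (S : BimonObj (σ.obj A)),
      σ.IsIteratedDoubleCross A bi act S ∧ IsBimonHom (σ.iterMul A j) := by
  induction σ with
  | single => exact ⟨PUnit.unit, bi 0, rfl, hj 0⟩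
  | pair s t ihs iht =>
    obtain ⟨⟨B, hB⟩, hs, ht⟩ := hσ
    obtain ⟨act₁, S₁, h₁, hom₁⟩ := ihs _ (fun i => bi _) _ (fun i => hj _) hs
    obtain ⟨act₂, S₂, h₂, hom₂⟩ := iht _ (fun i => bi _) _ (fun i => hj _) ht
    let := B.bimon
    have := B.isBimonHom
    obtain ⟨f, g, hf, hg, hfg, hincl⟩ := exists_factorization F _ _ B.incl B.injective hB
    refine ⟨((act₁, act₂), (leftAct f g, rightAct f g)), bimonOfIso (X := s.obj _ ⊗ t.obj _) (prodMap f g),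
      ⟨S₁, S₂, h₁, h₂, isDoubleCrossProduct_bimonOfIso f g⟩, ?_⟩
    have := isBimonHom_bimonOfIso (prodMap f g)
    -- `iterMul` of a pair of brackets is by definition the product of the two iterated products.
    change @IsBimonHom _ _ _ _ _ _ (_) _ (prodMap _ _)
    rw [← hincl]
    exact @isBimonHom_comp _ _ _ _ _ _ _ (_) _ _ _ _ this _

theorem exists_isIteratedHopfDoubleCross {n : ℕ} (σ : Bracketing n) (A : Fin n → C)
    (ho : ∀ i, HopfObj (A i)) (H : C) [HopfObj H] (j : ∀ i, A i ⟶ H)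
    (hj : ∀ i, IsBimonHom (j i)) (hσ : σ.BracketsHopfFactor F A j) :
    ∃ (act : σ.Actions A) (S : HopfObj (σ.obj A)),
      σ.IsIteratedHopfDoubleCross A ho act S ∧ IsBimonHom (σ.iterMul A j) := by
  induction σ with
  | single => exact ⟨PUnit.unit, ho 0, rfl, hj 0⟩
  | pair s t ihs iht =>
    obtain ⟨⟨B, hB⟩, hs, ht⟩ := hσ
    obtain ⟨act₁, S₁, h₁, hom₁⟩ := ihs _ (fun i => ho _) _ (fun i => hj _) hs
    obtain ⟨act₂, S₂, h₂, hom₂⟩ := iht _ (fun i => ho _) _ (fun i => hj _) ht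
    let := B.hopf
    have := B.isBimonHom
    obtain ⟨f, g, hf, hg, hfg, hincl⟩ := exists_factorization F _ _ B.incl B.injective hB
    refine ⟨((act₁, act₂), (leftAct f g, rightAct f g)), hopfOfIso (X := s.obj _ ⊗ t.obj _) (prodMap f g),
      ⟨S₁, S₂, h₁, h₂, isDoubleCrossProduct_bimonOfIso f g⟩, ?_⟩
    have := isBimonHom_bimonOfIso (prodMap f g)
    change @IsBimonHom _ _ _ _ _ _ (_) _ (prodMap _ _)
    rw [← hincl]
    exact @isBimonHom_comp _ _ _ _ _ _ _ (_) _ _ _ _ this _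

end Concrete

end BraidedFactorization

open BraidedFactorization in
theorem theorem1p2 {k : Type w} [Field k] {C : Type u} [Category.{v} C] [MonoidalCategory C]
    [BraidedCategory C] (F : C ⥤ ModuleCat.{w} k) [F.Monoidal] [F.Faithful]
    [F.ReflectsIsomorphisms] {n : ℕ} (hn : 2 ≤ n) (σ : Bracketing n) (A : Fin n → C) (H : C)
    (j : ∀ i, A i ⟶ H) :
    (∀ [bi : ∀ i, BimonObj (A i)] [BimonObj H], IsDoubleFactorization F σ A H j →
      ∃ (act : σ.Actions A) (S : BimonObj (σ.obj A)),
        σ.IsIteratedDoubleCross A bi act S ∧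
        IsIso (σ.iterMul A j) ∧ IsBimonHom (σ.iterMul A j)) ∧
    (∀ [ho : ∀ i, HopfObj (A i)] [HopfObj H], IsHopfDoubleFactorization F σ A H j →
      ∃ (act : σ.Actions A) (S : HopfObj (σ.obj A)),
        σ.IsIteratedHopfDoubleCross A ho act S ∧
        IsIso (σ.iterMul A j) ∧ IsBimonHom (σ.iterMul A j) ∧
        S.antipode ≫ σ.iterMul A j = σ.iterMul A j ≫ HopfObj.antipode) := by
  constructor
  · intro bi _ h
    obtain ⟨act, S, hS, hom⟩ := exists_isIteratedDoubleCross F σ A bi H j h.isBimonHom h.brackets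
    refine ⟨act, S, hS, ?_, hom⟩
    cases σ with
    | single => omega
    | pair s t =>
      obtain ⟨B, hB⟩ := h.brackets.1
      exact isIso_of_isBijectiveOnto F hB B.injective (B.range_eq.trans h.prod_eq_top)
  · intro ho _ h
    obtain ⟨act, S, hS, hom⟩ :=
      exists_isIteratedHopfDoubleCross F σ A ho H j h.isBimonHom h.brackets
    refine ⟨act, S, hS, ?_, hom, (HopfObj.hom_antipode (σ.iterMul A j)).symm⟩
    cases σ with
    | single => omega
    | pair s t =>
      obtain ⟨B, hB⟩ := h.brackets.1
      exact isIso_of_isBijectiveOnto F hB B.injective (B.range_eq.trans h.prod_eq_top)
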